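/- Let Thompson's group $F$ be the group of all strictly increasing piecewise linear homeomorphisms of $[0,1]$ with finitely many breakpoints, all at dyadic rational numbers, and with all slopes integer powers of $2$. Let $x_0,x_1\in F$ be the standard generators $$x_0(t)=\begin{cases}\frac t2,&0\le t\le\frac12,\\ t-\frac14,&\frac12\le t\le\frac34,\\ 2t-1,&\frac34\le t\le1,\end{cases}\qquad x_1(t)=\begin{cases}t,&0\le t\le\frac12,\\ \frac t2+\frac14,&\frac12\le t\le\frac34,\\ t-\frac18,&\frac34\le t\le\frac78,\\ 2t-1,&\frac78\le t\le1.\end{cases}$$ For $x\in(0,1)$ the marked Schreier graph $\Gamma_x$ is the oriented labelled graph whose vertices are the points of the $F$-orbit of $x$, with an arrow labelled $i\in\{0,1\}$ from $u$ to $v$ if and only if $x_i(u)=v$. The pointed marked Schreier graph of $x$ is $\Gamma_x$ with base vertex $x$. Isomorphisms of marked graphs preserve the orientations and the labels of arrows; isomorphisms of pointed marked graphs moreover preserve the base vertex. Then: 1. If $x,y\in(0,1)$ and $x\ne y$, then the pointed marked Schreier graphs of $x$ and $y$ are not isomorphic. 2. For all $x,y\in(0,1)$ the following conditions are equivalent: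 (a) $\Gamma_x$ and $\Gamma_y$ are isomorphic as marked graphs (without base vertex); (b) $x$ and $y$ belong to the same $F$-orbit; (c) $x$ and $y$ have binary expansions with the same tails, that is, there are binary expansions $x=0.a_1a_2a_3\ldots$ and $y=0.b_1b_2b_3\ldots$ and integers $m,n\ge0$ such that $a_{m+k}=b_{n+k}$ for all $k\ge1$. -/

import Mathlib

noncomputable section

namespace ThompsonSchreier

open unitInterval

/-- A real number is dyadic (rational) if it has the form `m / 2 ^ k`. -/
def IsDyadic (x : ℝ) : Prop := ∃ (m : ℤ) (k : ℕ), x = m / 2 ^ k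

/-- `B` is a set of breakpoints for `f`: on each interval `[a, b]` whose interior contains no
point of `B`, the function `f` is affine, and its slope is an integer power of `2`. -/
def IsBreakSet (B : Finset I) (f : I → I) : Prop :=
  ∀ a b : I, (∀ d ∈ B, d ∉ Set.Ioo a b) →
    ∃ (n : ℤ) (c : ℝ), ∀ t ∈ Set.Icc a b, (f t : ℝ) = (2 : ℝ) ^ n * (t : ℝ) + c

/-- The defining property of elements of Thompson's group: `f` is strictly increasing and
piecewise linear, with finitely many breakpoints, all of them dyadic rationals, and with slopes
that are integer powers of `2`. -/
def IsThompson (f : I ≃ₜ I) : Prop :=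
  StrictMono f ∧ ∃ B : Finset I, (∀ d ∈ B, IsDyadic (d : ℝ)) ∧ IsBreakSet B f

theorem IsDyadic.add {x y : ℝ} (hx : IsDyadic x) (hy : IsDyadic y) : IsDyadic (x + y) := by
  obtain ⟨m, k, rfl⟩ := hx
  obtain ⟨n, l, rfl⟩ := hy
  refine ⟨m * 2 ^ l + n * 2 ^ k, k + l, ?_⟩
  push_cast
  rw [pow_add]
  field_simp

theorem IsDyadic.neg {x : ℝ} (hx : IsDyadic x) : IsDyadic (-x) := by
  obtain ⟨m, k, rfl⟩ := hx
  exact ⟨-m, k, by push_cast; ring⟩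

theorem IsDyadic.sub {x y : ℝ} (hx : IsDyadic x) (hy : IsDyadic y) : IsDyadic (x - y) := by
  rw [sub_eq_add_neg]; exact hx.add hy.neg

theorem IsDyadic.zpow_mul {x : ℝ} (hx : IsDyadic x) (n : ℤ) : IsDyadic ((2 : ℝ) ^ n * x) := by
  obtain ⟨m, k, rfl⟩ := hx
  obtain ⟨l, rfl | rfl⟩ := n.eq_nat_or_neg
  · exact ⟨2 ^ l * m, k, by push_cast; rw [zpow_natCast]; ring⟩
  · refine ⟨m, l + k, ?_⟩
    rw [zpow_neg, zpow_natCast, pow_add]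
    field_simp

theorem isDyadic_zero : IsDyadic 0 := ⟨0, 0, by simp⟩

theorem strictMono_zero {f : I ≃ₜ I} (hf : StrictMono f) : f 0 = 0 := by
  obtain ⟨t, ht⟩ := f.surjective 0
  have : f 0 ≤ f t := hf.monotone unitInterval.nonneg'
  rw [ht] at this
  exact le_antisymm this unitInterval.nonneg'

/-- Below each point `t` lies a dyadic point `b` with a dyadic image such that `f` is affine on
`[b, t]`. -/
theorem exists_dyadic_below {f : I ≃ₜ I} (hf : StrictMono f) {B : Finset I}
    (hB : ∀ d ∈ B, IsDyadic (d : ℝ)) (hBf : IsBreakSet B f) (N : ℕ) :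
    ∀ t : I, (B.filter (· < t)).card ≤ N →
    ∃ b : I, b ≤ t ∧ IsDyadic (b : ℝ) ∧ IsDyadic (f b : ℝ) ∧
      ∃ n : ℤ, (f t : ℝ) = f b + (2 : ℝ) ^ n * ((t : ℝ) - b) := by
  induction N with
  | zero =>
    intro t ht
    have h0 : B.filter (· < t) = ∅ := Finset.card_eq_zero.mp (Nat.le_zero.mp ht)
    have h1 : (0 : I) ≤ t := unitInterval.nonneg'
    obtain ⟨n, c, h⟩ := hBf 0 t (fun d hd hd' => by
      have : d ∈ B.filter (· < t) := Finset.mem_filter.mpr ⟨hd, hd'.2⟩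
      simp [h0] at this)
    refine ⟨0, h1, by simpa using isDyadic_zero, ?_, n, ?_⟩
    · rw [strictMono_zero hf]; simpa using isDyadic_zero
    · rw [h t ⟨h1, le_rfl⟩, h 0 ⟨le_rfl, h1⟩]; ring
  | succ N ih =>
    intro t ht
    by_cases h0 : (B.filter (· < t)).Nonempty
    · obtain ⟨hbB, hbt⟩ := Finset.mem_filter.mp (Finset.max'_mem _ h0)
      set b := (B.filter (· < t)).max' h0 with hb
      have hcard : (B.filter (· < b)).card ≤ N := by
        have : (B.filter (· < b)).card < (B.filter (· < t)).card := by
          apply Finset.card_lt_card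
          rw [Finset.ssubset_iff_of_subset]
          · exact ⟨b, Finset.mem_filter.mpr ⟨hbB, hbt⟩, by simp⟩
          · intro d hd
            simp only [Finset.mem_filter] at hd ⊢
            exact ⟨hd.1, hd.2.trans hbt⟩
        omega
      obtain ⟨a, -, ha, hfa, m, hm⟩ := ih b hcard
      obtain ⟨n, c, h⟩ := hBf b t (fun d hd hd' => by
        have : d ≤ b := Finset.le_max' _ d (Finset.mem_filter.mpr ⟨hd, hd'.2⟩)
        exact absurd hd'.1 (not_lt.mpr this))
      refine ⟨b, hbt.le, hB b hbB, ?_, n, ?_⟩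
      · rw [hm]; exact hfa.add (((hB b hbB).sub ha).zpow_mul m)
      · rw [h t ⟨hbt.le, le_rfl⟩, h b ⟨le_rfl, hbt.le⟩]; ring
    · exact ih t (by rw [Finset.not_nonempty_iff_eq_empty.mp h0]; simp)

theorem IsThompson.isDyadic_iff {f : I ≃ₜ I} (hf : IsThompson f) (t : I) :
    IsDyadic (f t : ℝ) ↔ IsDyadic (t : ℝ) := by
  obtain ⟨hm, B, hB, hBf⟩ := hf
  obtain ⟨b, -, hb, hfb, n, hn⟩ := exists_dyadic_below hm hB hBf _ t le_rfl
  constructor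
  · intro h
    have : (t : ℝ) = b + (2 : ℝ) ^ (-n) * ((f t : ℝ) - f b) := by
      rw [hn, zpow_neg]
      have : (2 : ℝ) ^ n ≠ 0 := by positivity
      field_simp
      ring
    rw [this]
    exact hb.add ((h.sub hfb).zpow_mul _)
  · intro h
    rw [hn]
    exact hfb.add ((h.sub hb).zpow_mul n)

theorem isThompson_one : IsThompson 1 :=
  ⟨fun _ _ h => h, ∅, by simp, fun _ _ _ => ⟨0, 0, fun t _ => by simp⟩⟩

theorem strictMono_inv {f : I ≃ₜ I} (hf : StrictMono f) : StrictMono (f⁻¹ : I ≃ₜ I) := by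
  intro a b hab
  have h : ∀ c, f (f⁻¹ c) = c := fun c => f.apply_symm_apply c
  rw [← hf.lt_iff_lt, h, h]
  exact hab

theorem IsThompson.inv {f : I ≃ₜ I} (hf : IsThompson f) : IsThompson f⁻¹ := by
  have hiff := hf.isDyadic_iff
  obtain ⟨hm, B, hB, hBf⟩ := hf
  have hr : ∀ c, f (f⁻¹ c) = c := fun c => f.apply_symm_apply c
  have hl : ∀ c, f⁻¹ (f c) = c := fun c => f.symm_apply_apply c
  have hm' := strictMono_inv hm
  refine ⟨hm', B.image f, ?_, ?_⟩
  · intro d hd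
    obtain ⟨e, he, rfl⟩ := Finset.mem_image.mp hd
    exact (hiff e).mpr (hB e he)
  · intro a b hab
    obtain ⟨n, c, h⟩ := hBf (f⁻¹ a) (f⁻¹ b) (fun d hd hd' => by
      refine hab (f d) (Finset.mem_image_of_mem f hd) ⟨?_, ?_⟩
      · have := hm hd'.1; rwa [hr] at this
      · have := hm hd'.2; rwa [hr] at this)
    refine ⟨-n, -((2 : ℝ) ^ (-n) * c), fun t ht => ?_⟩
    have := h (f⁻¹ t) ⟨hm'.monotone ht.1, hm'.monotone ht.2⟩
    rw [hr] at this
    rw [this, zpow_neg]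
    have : (2 : ℝ) ^ n ≠ 0 := by positivity
    field_simp
    ring

theorem IsThompson.mul {f g : I ≃ₜ I} (hf : IsThompson f) (hg : IsThompson g) :
    IsThompson (f * g) := by
  have hiff := hg.isDyadic_iff
  obtain ⟨hm, B, hB, hBf⟩ := hf
  obtain ⟨km, C, hC, hCg⟩ := hg
  have hr : ∀ c, g (g⁻¹ c) = c := fun c => g.apply_symm_apply c
  have hl : ∀ c, g⁻¹ (g c) = c := fun c => g.symm_apply_apply c
  refine ⟨hm.comp km, C ∪ B.image (g⁻¹ : I ≃ₜ I), ?_, ?_⟩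
  · intro d hd
    rcases Finset.mem_union.mp hd with hd | hd
    · exact hC d hd
    · obtain ⟨e, he, rfl⟩ := Finset.mem_image.mp hd
      rw [← hiff, hr]
      exact hB e he
  · intro a b hab
    obtain ⟨n, c, h⟩ := hCg a b (fun d hd => hab d (Finset.mem_union_left _ hd))
    obtain ⟨m, e, k⟩ := hBf (g a) (g b) (fun d hd hd' => by
      refine hab (g⁻¹ d) (Finset.mem_union_right _ (Finset.mem_image_of_mem _ hd)) ⟨?_, ?_⟩
      · rw [← km.lt_iff_lt, hr]; exact hd'.1
      · rw [← km.lt_iff_lt, hr]; exact hd'.2)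
    refine ⟨m + n, (2 : ℝ) ^ m * c + e, fun t ht => ?_⟩
    have h1 := k (g t) ⟨km.monotone ht.1, km.monotone ht.2⟩
    rw [h t ht] at h1
    change (f (g t) : ℝ) = _
    rw [h1, zpow_add₀ two_ne_zero]
    ring

/-- Thompson's group `F`, as a subgroup of the group of all homeomorphisms of `[0, 1]`;
the product `f * g` is the map `t ↦ f (g t)`. -/
def F : Subgroup (I ≃ₜ I) where
  carrier := {f | IsThompson f}
  mul_mem' := IsThompson.mul
  one_mem' := isThompson_one
  inv_mem' := IsThompson.inv

/-- The standard action of `F` on `[0, 1]` by evaluation. -/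
instance : MulAction F I where
  smul f t := (f : I ≃ₜ I) t
  one_smul _ := rfl
  mul_smul _ _ _ := rfl

/-- A strictly increasing surjection of `[0, 1]` as a homeomorphism. -/
def homeoOfStrictMono (f : I → I) (hf : StrictMono f) (hs : Function.Surjective f) : I ≃ₜ I :=
  (hf.orderIsoOfSurjective f hs).toHomeomorph

theorem homeoOfStrictMono_apply (f : I → I) (hf : StrictMono f) (hs : Function.Surjective f)
    (t : I) : homeoOfStrictMono f hf hs t = f t := rfl

/-- The formula for the generator `x₀`. -/
def x₀Fun (t : ℝ) : ℝ :=
  if t ≤ 1 / 2 then t / 2 else if t ≤ 3 / 4 then t - 1 / 4 else 2 * t - 1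

/-- The formula for the generator `x₁`. -/
def x₁Fun (t : ℝ) : ℝ :=
  if t ≤ 1 / 2 then t else if t ≤ 3 / 4 then t / 2 + 1 / 4
  else if t ≤ 7 / 8 then t - 1 / 8 else 2 * t - 1

theorem x₀Fun_mem (t : I) : x₀Fun t ∈ I := by
  obtain ⟨t, h0, h1⟩ := t
  simp only [x₀Fun]
  constructor <;> split_ifs <;> linarith

theorem x₁Fun_mem (t : I) : x₁Fun t ∈ I := by
  obtain ⟨t, h0, h1⟩ := t
  simp only [x₁Fun]
  constructor <;> split_ifs <;> linarith

theorem x₀Fun_strictMono : StrictMono (fun t : I => (⟨x₀Fun t, x₀Fun_mem t⟩ : I)) := by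
  rintro ⟨s, hs⟩ ⟨t, ht⟩ (h : s < t)
  change x₀Fun s < x₀Fun t
  simp only [x₀Fun]
  split_ifs <;> linarith

theorem x₁Fun_strictMono : StrictMono (fun t : I => (⟨x₁Fun t, x₁Fun_mem t⟩ : I)) := by
  rintro ⟨s, hs⟩ ⟨t, ht⟩ (h : s < t)
  change x₁Fun s < x₁Fun t
  simp only [x₁Fun]
  split_ifs <;> linarith

theorem x₀Fun_surjective :
    Function.Surjective (fun t : I => (⟨x₀Fun t, x₀Fun_mem t⟩ : I)) := by
  rintro ⟨s, h0, h1⟩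
  rcases le_or_gt s (1 / 4) with h | h
  · refine ⟨⟨2 * s, by linarith, by linarith⟩, Subtype.ext ?_⟩
    simp only [x₀Fun]; split_ifs <;> linarith
  rcases le_or_gt s (1 / 2) with h' | h'
  · refine ⟨⟨s + 1 / 4, by linarith, by linarith⟩, Subtype.ext ?_⟩
    simp only [x₀Fun]; split_ifs <;> linarith
  · refine ⟨⟨(s + 1) / 2, by linarith, by linarith⟩, Subtype.ext ?_⟩
    simp only [x₀Fun]; split_ifs <;> linarith

theorem x₁Fun_surjective :
    Function.Surjective (fun t : I => (⟨x₁Fun t, x₁Fun_mem t⟩ : I)) := by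
  rintro ⟨s, h0, h1⟩
  rcases le_or_gt s (1 / 2) with h | h
  · refine ⟨⟨s, by linarith, by linarith⟩, Subtype.ext ?_⟩
    simp only [x₁Fun]; rw [if_pos h]
  rcases le_or_gt s (5 / 8) with h' | h'
  · refine ⟨⟨2 * s - 1 / 2, by linarith, by linarith⟩, Subtype.ext ?_⟩
    simp only [x₁Fun]; split_ifs <;> linarith
  rcases le_or_gt s (3 / 4) with h'' | h''
  · refine ⟨⟨s + 1 / 8, by linarith, by linarith⟩, Subtype.ext ?_⟩
    simp only [x₁Fun]; split_ifs <;> linarith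
  · refine ⟨⟨(s + 1) / 2, by linarith, by linarith⟩, Subtype.ext ?_⟩
    simp only [x₁Fun]; split_ifs <;> linarith

theorem isThompson_x₀ :
    IsThompson (homeoOfStrictMono _ x₀Fun_strictMono x₀Fun_surjective) := by
  refine ⟨x₀Fun_strictMono, {⟨1 / 2, by norm_num, by norm_num⟩, ⟨3 / 4, by norm_num, by norm_num⟩},
    ?_, ?_⟩
  · intro d hd
    simp only [Finset.mem_insert, Finset.mem_singleton] at hd
    rcases hd with rfl | rfl
    · exact ⟨1, 1, by norm_num⟩
    · exact ⟨3, 2, by norm_num⟩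
  · rintro ⟨a, ha⟩ ⟨b, hb⟩ h
    simp only [Finset.mem_insert, Finset.mem_singleton, forall_eq_or_imp, forall_eq, Set.mem_Ioo,
      not_and, not_lt, ← Subtype.coe_lt_coe, ← Subtype.coe_le_coe] at h
    simp only [homeoOfStrictMono_apply, Subtype.forall, Set.mem_Icc, Subtype.mk_le_mk]
    rcases le_or_gt b (1 / 2) with h1 | h1
    · refine ⟨-1, 0, fun t _ ht => ?_⟩
      simp only [x₀Fun]; rw [if_pos (by linarith)]; norm_num; ring
    have h1' : 1 / 2 ≤ a := by
      by_contra hc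
      linarith [h.1 (not_le.mp hc)]
    rcases le_or_gt b (3 / 4) with h2 | h2
    · refine ⟨0, -(1 / 4), fun t _ ht => ?_⟩
      simp only [x₀Fun, zpow_zero]; split_ifs <;> linarith
    have h2' : 3 / 4 ≤ a := by
      by_contra hc
      linarith [h.2 (not_le.mp hc)]
    refine ⟨1, -1, fun t _ ht => ?_⟩
    simp only [x₀Fun, zpow_one]; split_ifs <;> linarith

theorem isThompson_x₁ :
    IsThompson (homeoOfStrictMono _ x₁Fun_strictMono x₁Fun_surjective) := by
  refine ⟨x₁Fun_strictMono, {⟨1 / 2, by norm_num, by norm_num⟩, ⟨3 / 4, by norm_num, by norm_num⟩,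
    ⟨7 / 8, by norm_num, by norm_num⟩}, ?_, ?_⟩
  · intro d hd
    simp only [Finset.mem_insert, Finset.mem_singleton] at hd
    rcases hd with rfl | rfl | rfl
    · exact ⟨1, 1, by norm_num⟩
    · exact ⟨3, 2, by norm_num⟩
    · exact ⟨7, 3, by norm_num⟩
  · rintro ⟨a, ha⟩ ⟨b, hb⟩ h
    simp only [Finset.mem_insert, Finset.mem_singleton, forall_eq_or_imp, forall_eq, Set.mem_Ioo,
      not_and, not_lt, ← Subtype.coe_lt_coe, ← Subtype.coe_le_coe] at h
    simp only [homeoOfStrictMono_apply, Subtype.forall, Set.mem_Icc, Subtype.mk_le_mk]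
    rcases le_or_gt b (1 / 2) with h1 | h1
    · refine ⟨0, 0, fun t _ ht => ?_⟩
      simp only [x₁Fun, zpow_zero]; rw [if_pos (by linarith)]; ring
    have h1' : 1 / 2 ≤ a := by
      by_contra hc
      linarith [h.1 (not_le.mp hc)]
    rcases le_or_gt b (3 / 4) with h2 | h2
    · refine ⟨-1, 1 / 4, fun t _ ht => ?_⟩
      have e : (2 : ℝ) ^ (-1 : ℤ) = 1 / 2 := by norm_num
      simp only [x₁Fun, e]; split_ifs <;> linarith
    have h2' : 3 / 4 ≤ a := by
      by_contra hc
      linarith [h.2.1 (not_le.mp hc)]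
    rcases le_or_gt b (7 / 8) with h3 | h3
    · refine ⟨0, -(1 / 8), fun t _ ht => ?_⟩
      simp only [x₁Fun, zpow_zero]; split_ifs <;> linarith
    have h3' : 7 / 8 ≤ a := by
      by_contra hc
      linarith [h.2.2 (not_le.mp hc)]
    refine ⟨1, -1, fun t _ ht => ?_⟩
    simp only [x₁Fun, zpow_one]; split_ifs <;> linarith

/-- The generator `x₀` of `F`. -/
def x₀ : F := ⟨_, isThompson_x₀⟩

/-- The generator `x₁` of `F`. -/
def x₁ : F := ⟨_, isThompson_x₁⟩

/-- The standard generating family `(x₀, x₁)`, indexed by the labels `0` and `1`. -/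
def gen : Fin 2 → F := ![x₀, x₁]

/-- The (unpointed) marked Schreier graph of the point `x`: its vertices are the points of the
`F`-orbit of `x`, and there is an arrow labelled `i` from `u` to `v` iff `gen i • u = v`. -/
abbrev Schreier (x : I) : Type := Quiver.SchreierGraph (MulAction.orbit F x) gen

/-- The base vertex of the pointed Schreier graph of `x`. -/
def base (x : I) : Schreier x := ⟨⟨x, MulAction.mem_orbit_self x⟩⟩

/-- The label of an arrow of the Schreier graph of `x`. -/
def label {x : I} {u v : Schreier x} (a : u ⟶ v) : Fin 2 :=
  (Quiver.SchreierGraph.labelling (MulAction.orbit F x) gen).map a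

/-- Isomorphisms of (unpointed) marked Schreier graphs: bijections of vertices and of arrows
that preserve sources, targets and labels of arrows. -/
structure MarkedIso (x y : I) where
  onVertices : Schreier x ≃ Schreier y
  onArrows : ∀ u v : Schreier x, (u ⟶ v) ≃ (onVertices u ⟶ onVertices v)
  label_onArrows : ∀ (u v : Schreier x) (a : u ⟶ v), label (onArrows u v a) = label a

/-- The pointed marked Schreier graphs of `x` and `y` are isomorphic. -/
def PointedIsomorphic (x y : I) : Prop :=
  ∃ φ : MarkedIso x y, φ.onVertices (base x) = base y

/-- The unpointed marked Schreier graphs of `x` and `y` are isomorphic. -/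
def Isomorphic (x y : I) : Prop := Nonempty (MarkedIso x y)

/-- `x` and `y` have binary expansions with the same tails: some binary expansion of `x` and some
binary expansion of `y` agree after deletion of finite, possibly different, numbers of initial
digits. -/
def SameTails (x y : I) : Prop :=
  ∃ a b : ℕ → Fin 2, Real.ofDigits a = (x : ℝ) ∧ Real.ofDigits b = (y : ℝ) ∧
    ∃ m n : ℕ, ∀ k : ℕ, a (m + k) = b (n + k)

end ThompsonSchreier

end

/-!
Say that `x` and `y` are dyadically equivalent if `2 ^ p * y = 2 ^ q * x + c` for some natural
numbers `p`, `q` and some integer `c`. Points with the same binary tails are of this kind, and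
conversely the floor formula for binary digits turns such a relation into a common tail. Elements of
`F` are piecewise of the form `t ↦ 2 ^ n * t + c` with `c` dyadic, so points of one orbit are
dyadically equivalent.

For the converse, `x₀` and `x₁` already suffice. Identify `[1/2, 3/4)` with `[0, 1)` via
`1/2 + s/4 ↔ s`. On `[1/2, 3/4)`, orbits of the subgroup generated by `x₀` and `x₁` are invariant
under the doubling map `s ↦ fract (2 * s)`, and `x ∈ (0, 1)` lies in the orbit of the point
corresponding to `fract (2 ^ n * x)` for all large `n`; this point does not change when an integer
is added to `2 ^ n * x`.

In particular that subgroup acts transitively on the dyadic points of `(0, 1)`. Hence for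
`x < y < 1` some conjugate of `x₁` is trivial exactly to the left of a dyadic point between `x` and
`y`: it fixes `x` and moves `y`. An isomorphism of marked Schreier graphs commutes with the
generators, so it preserves the stabilizers of vertices and must send each point to itself.
-/

namespace ThompsonSchreier

open unitInterval MulAction

/-- Dyadic equivalence of real numbers: `y = 2 ^ (q - p) * x + c / 2 ^ p` for some `p`, `q` and
some integer `c`, written without denominators. On `(0, 1)` this is both the orbit relation of
Thompson's group and the relation of having binary expansions with the same tails. -/
def DyadicEquiv (x y : ℝ) : Prop :=
  ∃ (p q : ℕ) (c : ℤ), 2 ^ p * y = 2 ^ q * x + c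

theorem IsDyadic.dyadicEquiv {x y : ℝ} (hx : IsDyadic x) (hy : IsDyadic y) : DyadicEquiv x y := by
  obtain ⟨m, k, rfl⟩ := hx
  obtain ⟨n, l, rfl⟩ := hy
  refine ⟨l, k, n - m, ?_⟩
  push_cast
  field_simp
  ring

theorem exists_isDyadic_btwn {x y : ℝ} (hxy : x < y) : ∃ d, IsDyadic d ∧ x < d ∧ d < y := by
  obtain ⟨k, hk⟩ := pow_unbounded_of_one_lt (y - x)⁻¹ (one_lt_two (α := ℝ))
  obtain ⟨m, hxm, hmy⟩ := exists_div_btwn (n := 2 ^ k) hxy (by exact_mod_cast hk)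
  push_cast at hxm hmy
  exact ⟨m / 2 ^ k, ⟨m, k, rfl⟩, hxm, hmy⟩

section BinaryExpansions

theorem exists_pow_mul_ofDigits_eq_natCast_add {b : ℕ} (a : ℕ → Fin b) (n : ℕ) :
    ∃ A : ℕ, b ^ n * Real.ofDigits a = A + Real.ofDigits (fun k => a (n + k)) := by
  have hb : (b : ℝ) ≠ 0 := by exact_mod_cast (a 0).pos.ne'
  have shift_digits (i : ℕ) (hi : i ∈ Finset.range n) :
      (b : ℝ) ^ n * Real.ofDigitsTerm a i = ((a i * b ^ (n - (i + 1)) : ℕ) : ℝ) := by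
    have hn : n - (i + 1) + (i + 1) = n := Nat.sub_add_cancel (Finset.mem_range.mp hi)
    rw [Real.ofDigitsTerm, ← hn, pow_add, hn]
    push_cast
    field_simp
  refine ⟨∑ i ∈ Finset.range n, a i * b ^ (n - (i + 1)), ?_⟩
  rw [Real.ofDigits_eq_sum_add_ofDigits a n, mul_add, Finset.mul_sum,
    Finset.sum_congr rfl shift_digits, mul_inv_cancel_left₀ (pow_ne_zero n hb), Nat.cast_sum]
  simp only [add_comm]

theorem intCast_digits {b : ℕ} [NeZero b] {x : ℝ} (hx : 0 ≤ x) (i : ℕ) :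
    ((Real.digits x b i : ℕ) : ℤ) = ⌊b ^ (i + 1) * x⌋ % b := by
  have h : (0 : ℝ) ≤ b ^ (i + 1) * x := by positivity
  rw [Real.digits, Fin.val_ofNat, ← Int.natCast_floor_eq_floor h, mul_comm]
  norm_cast

theorem SameTails.dyadicEquiv {x y : I} (h : SameTails x y) : DyadicEquiv x y := by
  obtain ⟨a, b, ha, hb, m, n, hab⟩ := h
  obtain ⟨A, hA⟩ := exists_pow_mul_ofDigits_eq_natCast_add a m
  obtain ⟨B, hB⟩ := exists_pow_mul_ofDigits_eq_natCast_add b n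
  rw [ha, funext hab] at hA
  rw [hb] at hB
  refine ⟨n, m, B - A, ?_⟩
  push_cast at hA hB ⊢
  linear_combination hB - hA

theorem DyadicEquiv.sameTails {x y : I} (hx : x < 1) (hy : y < 1) (h : DyadicEquiv x y) :
    SameTails x y := by
  obtain ⟨p, q, c, hc⟩ := h
  refine ⟨Real.digits x 2, Real.digits y 2, Real.ofDigits_digits one_lt_two ⟨x.2.1, hx⟩,
    Real.ofDigits_digits one_lt_two ⟨y.2.1, hy⟩, q, p, fun k => Fin.ext ?_⟩
  have shift : (2 : ℝ) ^ (p + k + 1) * y = 2 ^ (q + k + 1) * x + (2 * (2 ^ k * c) : ℤ) := by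
    push_cast
    linear_combination 2 ^ (k + 1) * hc
  zify
  rw [intCast_digits x.2.1, intCast_digits y.2.1, Nat.cast_ofNat, Nat.cast_ofNat, shift,
    Int.floor_add_intCast, Int.add_mul_emod_self_left]

theorem dyadicEquiv_iff_sameTails {x y : I} (hx : x < 1) (hy : y < 1) :
    DyadicEquiv x y ↔ SameTails x y :=
  ⟨DyadicEquiv.sameTails hx hy, SameTails.dyadicEquiv⟩

end BinaryExpansions

section Action

theorem strictMono_smul (g : F) : StrictMono (fun t : I => g • t) := g.2.1

theorem smul_lt_one (g : F) {t : I} (ht : t < 1) : g • t < 1 :=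
  (strictMono_smul g ht).trans_le unitInterval.le_one'

theorem dyadicEquiv_smul (g : F) (t : I) : DyadicEquiv t (g • t : I) := by
  obtain ⟨hg, B, hB, hBg⟩ := g.2
  obtain ⟨b, -, hb, hgb, n, hn⟩ := exists_dyadic_below hg hB hBg _ t le_rfl
  obtain ⟨c, k, hc⟩ := hgb.sub (hb.zpow_mul n)
  have affine : ((g • t : I) : ℝ) = 2 ^ n * t + c / 2 ^ k :=
    calc ((g • t : I) : ℝ) = (g : I ≃ₜ I) b + 2 ^ n * ((t : ℝ) - b) := hn
      _ = 2 ^ n * t + c / 2 ^ k := by rw [← hc]; ring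
  obtain ⟨l, rfl | rfl⟩ := n.eq_nat_or_neg
  · refine ⟨k, k + l, c, ?_⟩
    rw [affine, zpow_natCast, pow_add]
    field_simp
  · refine ⟨k + l, k, 2 ^ l * c, ?_⟩
    rw [affine, zpow_neg, zpow_natCast, pow_add]
    push_cast
    field_simp

theorem coe_x₀_smul (t : I) : ((x₀ • t : I) : ℝ) = x₀Fun t := rfl

theorem coe_x₁_smul (t : I) : ((x₁ • t : I) : ℝ) = x₁Fun t := rfl

theorem x₁_smul_eq_self_iff {t : I} : x₁ • t = t ↔ (t : ℝ) ≤ 1 / 2 ∨ t = 1 := by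
  rw [Subtype.ext_iff, Subtype.ext_iff, coe_x₁_smul, x₁Fun, Set.Icc.coe_one]
  split_ifs with h₁ h₂ h₃
  · simp only [h₁, true_or]
  all_goals
    constructor
    · intro h
      right
      linarith
    · rintro (h | h) <;> linarith

end Action

section Generators

/-- The subgroup of `F` generated by `x₀` and `x₁`: the elements whose action can be read off from
paths in the marked Schreier graphs. -/
def genClosure : Subgroup F := Subgroup.closure (Set.range gen)

theorem x₀_mem_genClosure : x₀ ∈ genClosure := Subgroup.subset_closure ⟨0, rfl⟩

theorem x₁_mem_genClosure : x₁ ∈ genClosure := Subgroup.subset_closure ⟨1, rfl⟩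

theorem orbit_x₀_smul (t : I) : orbit genClosure (x₀ • t) = orbit genClosure t :=
  orbit_smul (⟨x₀, x₀_mem_genClosure⟩ : genClosure) t

theorem orbit_x₁_smul (t : I) : orbit genClosure (x₁ • t) = orbit genClosure t :=
  orbit_smul (⟨x₁, x₁_mem_genClosure⟩ : genClosure) t

/-- The point of `[1/2, 3/4)` that corresponds to `r` modulo `1` under the affine identification of
`[1/2, 3/4)` with `[0, 1)`. -/
noncomputable def window (r : ℝ) : I :=
  ⟨1 / 2 + Int.fract r / 4, by linarith [Int.fract_nonneg r], by linarith [Int.fract_lt_one r]⟩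

theorem window_add_intCast (r : ℝ) (c : ℤ) : window (r + c) = window r :=
  Subtype.ext (by simp only [window, Int.fract_add_intCast])

theorem coe_window (r : ℝ) : (window r : ℝ) = 1 / 2 + Int.fract r / 4 := rfl

theorem orbit_window_two_mul (r : ℝ) :
    orbit genClosure (window (2 * r)) = orbit genClosure (window r) := by
  have hr := Int.floor_add_fract r
  have hr₀ := Int.fract_nonneg r
  have hr₁ := Int.fract_lt_one r
  rcases lt_or_ge (Int.fract r) (1 / 2) with h | h
  · have fract_double : Int.fract (2 * r) = 2 * Int.fract r :=
      Int.fract_eq_iff.mpr ⟨by linarith, by linarith, 2 * ⌊r⌋, by push_cast; linarith⟩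
    have x₁_window : x₁ • window (2 * r) = window r := by
      apply Subtype.ext
      rw [coe_x₁_smul, x₁Fun, coe_window, coe_window, fract_double]
      split_ifs <;> linarith
    rw [← x₁_window, orbit_x₁_smul]
  · have fract_double : Int.fract (2 * r) = 2 * Int.fract r - 1 :=
      Int.fract_eq_iff.mpr ⟨by linarith, by linarith, 2 * ⌊r⌋ + 1, by push_cast; linarith⟩
    -- The point of `[3/4, 7/8)` that `x₁` translates to `window r` is sent by `x₀` to
    -- `window (2 * r)`.
    obtain ⟨u, hu⟩ : ∃ u : I, (u : ℝ) = 5 / 8 + Int.fract r / 4 :=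
      ⟨⟨5 / 8 + Int.fract r / 4, by linarith, by linarith⟩, rfl⟩
    have x₁_u : x₁ • u = window r := by
      apply Subtype.ext
      rw [coe_x₁_smul, x₁Fun, coe_window, hu]
      split_ifs <;> linarith
    have x₀_u : x₀ • u = window (2 * r) := by
      apply Subtype.ext
      rw [coe_x₀_smul, x₀Fun, coe_window, fract_double, hu]
      split_ifs <;> linarith
    rw [← x₀_u, ← x₁_u, orbit_x₀_smul, orbit_x₁_smul]

theorem orbit_window_four_mul {x : I} (hx : (x : ℝ) ∈ Set.Ico (1 / 4) (3 / 4)) :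
    orbit genClosure (window (4 * x)) = orbit genClosure x := by
  obtain ⟨h₁, h₃⟩ := hx
  rcases lt_or_ge (x : ℝ) (1 / 2) with h₂ | h₂
  · have fract_eq : Int.fract (4 * (x : ℝ)) = 4 * x - 1 :=
      Int.fract_eq_iff.mpr ⟨by linarith, by linarith, 1, by push_cast; ring⟩
    have x₀_window : x₀ • window (4 * x) = x := by
      apply Subtype.ext
      rw [coe_x₀_smul, x₀Fun, coe_window, fract_eq]
      split_ifs <;> linarith
    rw [← orbit_x₀_smul, x₀_window]
  · have fract_eq : Int.fract (4 * (x : ℝ)) = 4 * x - 2 :=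
      Int.fract_eq_iff.mpr ⟨by linarith, by linarith, 2, by push_cast; ring⟩
    have window_eq : window (4 * x) = x := by
      apply Subtype.ext
      rw [coe_window, fract_eq]
      ring
    rw [window_eq]

theorem exists_orbit_eq_two_mul_add_intCast {x : I} {ε : ℝ}
    (hx : (x : ℝ) ∉ Set.Ico (1 / 4) (3 / 4)) (hε : (x : ℝ) ∈ Set.Icc (ε / 2) (1 - ε / 2)) :
    ∃ y : I, orbit genClosure y = orbit genClosure x ∧ (y : ℝ) ∈ Set.Icc ε (1 - ε) ∧
      ∃ c : ℤ, (y : ℝ) = 2 * x + c := by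
  have hx₀ := x.2.1
  obtain ⟨hε₀, hε₁⟩ := hε
  rcases lt_or_ge (x : ℝ) (1 / 4) with h | h
  · let y : I := ⟨2 * x, by linarith, by linarith⟩
    have x₀_y : x₀ • y = x := by
      apply Subtype.ext
      rw [coe_x₀_smul, x₀Fun]
      split_ifs <;> linarith
    refine ⟨y, by rw [← orbit_x₀_smul, x₀_y], ⟨?_, ?_⟩, 0, by simp [y]⟩ <;>
      linarith
  · have h' : 3 / 4 ≤ (x : ℝ) := not_lt.mp fun h' => hx ⟨h, h'⟩
    have x₀_x : ((x₀ • x : I) : ℝ) = 2 * x - 1 := by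
      rw [coe_x₀_smul, x₀Fun]
      split_ifs <;> linarith
    refine ⟨x₀ • x, orbit_x₀_smul x, ⟨?_, ?_⟩, -1, by rw [x₀_x]; push_cast; ring⟩ <;>
      linarith

theorem exists_orbit_window_two_pow_mul (m : ℕ) {x : I}
    (hx : (x : ℝ) ∈ Set.Icc ((1 / 2) ^ m) (1 - (1 / 2) ^ m)) :
    ∃ n : ℕ, orbit genClosure (window (2 ^ n * x)) = orbit genClosure x := by
  induction m generalizing x with
  | zero => norm_num at hx
  | succ m ih =>
    by_cases hmid : (x : ℝ) ∈ Set.Ico (1 / 4) (3 / 4)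
    · exact ⟨2, by rw [← orbit_window_four_mul hmid]; norm_num⟩
    · rw [pow_succ, mul_one_div] at hx
      obtain ⟨y, horbit, hy, c, hc⟩ := exists_orbit_eq_two_mul_add_intCast hmid hx
      obtain ⟨n, hn⟩ := ih hy
      have shift : (2 : ℝ) ^ n * y = 2 ^ (n + 1) * x + (2 ^ n * c : ℤ) := by
        rw [hc]
        push_cast
        ring
      exact ⟨n + 1, by rw [← horbit, ← hn, shift, window_add_intCast]⟩

theorem eventually_orbit_window_two_pow_mul {x : I} (hx : x ∈ Set.Ioo (0 : I) 1) :
    ∀ᶠ n : ℕ in Filter.atTop,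
      orbit genClosure (window (2 ^ n * x)) = orbit genClosure x := by
  have hx₀ : (0 : ℝ) < x := hx.1
  have hx₁ : (x : ℝ) < 1 := hx.2
  obtain ⟨m, hm⟩ := exists_pow_lt_of_lt_one (lt_min hx₀ (sub_pos.mpr hx₁)) one_half_lt_one
  obtain ⟨hm₀, hm₁⟩ := lt_min_iff.mp hm
  obtain ⟨n₀, hn₀⟩ := exists_orbit_window_two_pow_mul m (x := x) ⟨hm₀.le, by linarith⟩
  filter_upwards [Filter.eventually_ge_atTop n₀] with n hn
  induction n, hn using Nat.le_induction with
  | base => exact hn₀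
  | succ n _ ih => rw [pow_succ', mul_assoc, orbit_window_two_mul, ih]

theorem DyadicEquiv.mem_orbit_genClosure {x y : I} (hx : x ∈ Set.Ioo (0 : I) 1)
    (hy : y ∈ Set.Ioo (0 : I) 1) (h : DyadicEquiv x y) : y ∈ orbit genClosure x := by
  obtain ⟨p, q, c, hc⟩ := h
  obtain ⟨n, hxn, hyn⟩ :=
    (((Filter.tendsto_add_atTop_nat q).eventually (eventually_orbit_window_two_pow_mul hx)).and
      ((Filter.tendsto_add_atTop_nat p).eventually
        (eventually_orbit_window_two_pow_mul hy))).exists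
  have shift : (2 : ℝ) ^ (n + p) * y = 2 ^ (n + q) * x + (2 ^ n * c : ℤ) := by
    push_cast
    linear_combination 2 ^ n * hc
  rw [← orbit_eq_iff, ← hyn, ← hxn, shift, window_add_intCast]

theorem dyadicEquiv_iff_mem_orbit {x y : I} (hx : x ∈ Set.Ioo (0 : I) 1)
    (hy : y ∈ Set.Ioo (0 : I) 1) : DyadicEquiv x y ↔ y ∈ orbit F x := by
  constructor
  · intro h
    obtain ⟨g, hg⟩ := h.mem_orbit_genClosure hx hy
    exact ⟨g, hg⟩
  · rintro ⟨g, rfl⟩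
    exact dyadicEquiv_smul g x

theorem exists_smul_eq_self_and_smul_ne_self {x y : I} (hxy : x < y) (hy : y < 1) :
    ∃ g : genClosure, g • x = x ∧ g • y ≠ y := by
  obtain ⟨d, hd, hxd, hdy⟩ := exists_isDyadic_btwn (show (x : ℝ) < y from hxy)
  let d' : I := ⟨d, x.2.1.trans hxd.le, hdy.le.trans y.2.2⟩
  let half : I := ⟨1 / 2, by norm_num, by norm_num⟩
  have hd' : d' ∈ Set.Ioo (0 : I) 1 := ⟨x.2.1.trans_lt hxd, hdy.trans_le y.2.2⟩
  have half_mem : half ∈ Set.Ioo (0 : I) 1 :=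
    ⟨show (0 : ℝ) < 1 / 2 by norm_num, show (1 / 2 : ℝ) < 1 by norm_num⟩
  obtain ⟨h, hh : h • d' = half⟩ :=
    (hd.dyadicEquiv (y := half) ⟨1, 1, by norm_num [half]⟩).mem_orbit_genClosure hd' half_mem
  have hx_half : h • x < half := hh ▸ strictMono_smul (h : F) (show x < d' from hxd)
  have half_hy : half < h • y := hh ▸ strictMono_smul (h : F) (show d' < y from hdy)
  let k : genClosure := ⟨x₁, x₁_mem_genClosure⟩
  refine ⟨h⁻¹ * k * h, ?_, ?_⟩
  · rw [mul_smul, mul_smul, inv_smul_eq_iff]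
    exact x₁_smul_eq_self_iff.mpr (Or.inl hx_half.le)
  · rw [mul_smul, mul_smul, Ne, inv_smul_eq_iff]
    exact fun hfix => (x₁_smul_eq_self_iff.mp hfix).elim (not_le.mpr half_hy)
      (smul_lt_one (h : F) hy).ne

theorem injOn_stabilizer_genClosure : Set.InjOn (stabilizer genClosure) (Set.Iio (1 : I)) := by
  have ne_of_lt {x y : I} (hxy : x < y) (hy : y < 1) :
      stabilizer genClosure x ≠ stabilizer genClosure y := by
    obtain ⟨g, hgx, hgy⟩ := exists_smul_eq_self_and_smul_ne_self hxy hy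
    exact fun h => hgy (mem_stabilizer_iff.mp (h ▸ mem_stabilizer_iff.mpr hgx))
  intro x hx y hy h
  by_contra hne
  rcases lt_or_gt_of_ne hne with hxy | hyx
  · exact ne_of_lt hxy hy h
  · exact ne_of_lt hyx hx h.symm

end Generators

section MarkedGraphs

variable {x y : I}

/-- The point of `[0, 1]` underlying a vertex of a Schreier graph. -/
def point (u : Schreier x) : I := u.toVertex

theorem point_injective : Function.Injective (point (x := x)) := fun _ _ h =>
  Quiver.SchreierGraph.ext (Subtype.ext h)

theorem point_smul (g : F) (u : Schreier x) : point (g • u) = g • point u := rfl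

theorem point_mem_orbit (u : Schreier x) : point u ∈ orbit F x := u.toVertex.2

theorem point_lt_one (hx : x < 1) (u : Schreier x) : point u < 1 := by
  obtain ⟨g, hg : g • x = point u⟩ := point_mem_orbit u
  exact hg ▸ smul_lt_one g hx

theorem MarkedIso.onVertices_gen_smul (φ : MarkedIso x y) (i : Fin 2) (u : Schreier x) :
    φ.onVertices (gen i • u) = gen i • φ.onVertices u :=
  Quiver.SchreierGraph.map_smul_of_comp_labelling_eq gen ⟨φ.onVertices, φ.onArrows _ _⟩
    (Prefunctor.ext (fun _ => rfl) φ.label_onArrows) u i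

theorem MarkedIso.onVertices_smul (φ : MarkedIso x y) {g : F} (hg : g ∈ genClosure)
    (u : Schreier x) : φ.onVertices (g • u) = g • φ.onVertices u := by
  induction hg using Subgroup.closure_induction generalizing u with
  | mem g hg =>
    obtain ⟨i, rfl⟩ := hg
    exact φ.onVertices_gen_smul i u
  | one => simp only [one_smul]
  | mul g h _ _ ihg ihh => rw [mul_smul, mul_smul, ihg, ihh]
  | inv g _ ih => rw [eq_inv_smul_iff, ← ih, smul_inv_smul]

theorem MarkedIso.stabilizer_point_onVertices (φ : MarkedIso x y) (u : Schreier x) :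
    stabilizer genClosure (point (φ.onVertices u)) = stabilizer genClosure (point u) := by
  ext ⟨g, hg⟩
  rw [mem_stabilizer_iff, mem_stabilizer_iff, Subgroup.mk_smul, Subgroup.mk_smul, ← point_smul,
    ← point_smul, point_injective.eq_iff, point_injective.eq_iff, ← φ.onVertices_smul hg,
    φ.onVertices.injective.eq_iff]

theorem MarkedIso.point_onVertices (φ : MarkedIso x y) (hx : x < 1) (hy : y < 1)
    (u : Schreier x) : point (φ.onVertices u) = point u :=
  injOn_stabilizer_genClosure (point_lt_one hy _) (point_lt_one hx u)
    (φ.stabilizer_point_onVertices u)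

theorem PointedIsomorphic.eq (h : PointedIsomorphic x y) (hx : x < 1) (hy : y < 1) : x = y := by
  obtain ⟨φ, hφ⟩ := h
  calc x = point (base x) := rfl
    _ = point (φ.onVertices (base x)) := (φ.point_onVertices hx hy (base x)).symm
    _ = point (base y) := by rw [hφ]
    _ = y := rfl

theorem Isomorphic.mem_orbit (h : Isomorphic x y) (hx : x < 1) (hy : y < 1) :
    y ∈ orbit F x := by
  obtain ⟨φ⟩ := h
  have point_eq : point (φ.onVertices (base x)) = x := φ.point_onVertices hx hy (base x)
  rw [mem_orbit_symm, ← point_eq]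
  exact point_mem_orbit (φ.onVertices (base x))

theorem isomorphic_of_mem_orbit (h : y ∈ orbit F x) : Isomorphic x y := by
  have orbit_eq : orbit F x = orbit F y := (orbit_eq_iff.mpr h).symm
  let e : Schreier x ≃ Schreier y :=
    ((Quiver.SchreierGraph.equiv _ gen).symm.trans (Equiv.setCongr orbit_eq)).trans
      (Quiver.SchreierGraph.equiv _ gen)
  have e_gen_smul (i : Fin 2) (u : Schreier x) : e (gen i • u) = gen i • e u := rfl
  refine ⟨⟨e, fun u v => Equiv.subtypeEquivRight fun i => ?_, fun _ _ _ => rfl⟩⟩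
  rw [← e_gen_smul, e.injective.eq_iff]

theorem isomorphic_iff_mem_orbit (hx : x < 1) (hy : y < 1) :
    Isomorphic x y ↔ y ∈ orbit F x :=
  ⟨fun h => h.mem_orbit hx hy, isomorphic_of_mem_orbit⟩

end MarkedGraphs

end ThompsonSchreier

theorem mainTheorem10 :
    (∀ x y : unitInterval, x ∈ Set.Ioo (0 : unitInterval) 1 → y ∈ Set.Ioo (0 : unitInterval) 1 →
      x ≠ y → ¬ ThompsonSchreier.PointedIsomorphic x y) ∧
    (∀ x y : unitInterval, x ∈ Set.Ioo (0 : unitInterval) 1 → y ∈ Set.Ioo (0 : unitInterval) 1 →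
      List.TFAE [ThompsonSchreier.Isomorphic x y,
        y ∈ MulAction.orbit ThompsonSchreier.F x,
        ThompsonSchreier.SameTails x y]) := by
  refine ⟨fun x y hx hy hne h => hne (h.eq hx.2 hy.2), fun x y hx hy => ?_⟩
  tfae_have 1 ↔ 2 := ThompsonSchreier.isomorphic_iff_mem_orbit hx.2 hy.2
  tfae_have 2 ↔ 3 := (ThompsonSchreier.dyadicEquiv_iff_mem_orbit hx hy).symm.trans
    (ThompsonSchreier.dyadicEquiv_iff_sameTails hx.2 hy.2)
  tfae_finish
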